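/- Let $\kappa,a,r>0$ be real and $n\ge 0$ an integer. Let $L_n(t)=\sum_{k=0}^n\binom nk\frac{(-t)^k}{k!}$ be the Laguerre polynomials and let $K_0,K_1$ be the modified Hankel functions (Macdonald functions, i.e. modified Bessel functions of the second kind) of order $0$ and $1$, $K_\nu(z)=\int_0^\infty e^{-z\cosh s}\cosh(\nu s)\,ds$ for $z>0$. For $\gamma>0$ define real numbers $a_{n,m}(\gamma)$, $0\le m\le n$, by $$a_{n,0}(\gamma)=1\ (n\ge0),\qquad a_{n,n}(\gamma)=-\frac{\gamma}{n}\,a_{n-1,n-1}(\gamma)\ (n\ge1),$$ and, for $m=n-1,\dots,1$, $$a_{n,m}(\gamma)=\frac1{2\gamma m}\Bigl\{4\Bigl[\frac{m+1}2\Bigr]^2a_{n,m+1}(\gamma)-\gamma^2\sum_{k=m-1}^{n-1}(n-k+1)\,a_{k,m-1}(\gamma)\Bigr\},$$ where $[\cdot]$ is the integer part. Put $$v_n(\gamma,r)=\sum_{m=0}^{[n/2]}a_{n,2m}(\gamma)r^{2m},\qquad w_n(\gamma,r)=\sum_{m=0}^{[(n-1)/2]}a_{n,2m+1}(\gamma)r^{2m+1}\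 (n\ge 1),\qquad w_0=0,$$ $$\Phi_n(\gamma,r)=K_0(\gamma r)\,v_n(\gamma,r)+K_1(\gamma r)\,w_n(\gamma,r)\quad(n\ge0),\qquad \Phi_n=0\quad(n<0).$$ Then the following two integrals converge absolutely and $$\int_{r/a}^\infty\frac{e^{-\kappa t}L_n(\kappa t)}{\sqrt{t^2-(r/a)^2}}\,dt=\Phi_n\bigl(\tfrac{\kappa}{a},r\bigr),\qquad \int_{r/a}^\infty\frac{e^{-\kappa t}(\kappa t)^2L_n(\kappa t)}{\sqrt{t^2-(r/a)^2}}\,dt=\sum_{k=-2}^{2}\chi_{k,n}\,\Phi_{n+k}\bigl(\tfrac{\kappa}{a},r\bigr),$$ where $\chi_{-2,n}=n(n-1)$, $\chi_{-1,n}=-4n^2$, $\chi_{0,n}=2(3n^2+3n+1)$, $\chi_{1,n}=-4(n+1)^2$ and $\chi_{2,n}=(n+1)(n+2)$. -/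

import Mathlib

noncomputable section

/-- The Laguerre polynomial `L_n(t) = ∑_{k=0}^n C(n,k) (-t)^k / k!`. -/
def laguerreL (n : ℕ) (t : ℝ) : ℝ :=
  ∑ k ∈ Finset.range (n + 1), (n.choose k : ℝ) * (-t) ^ k / (k.factorial : ℝ)

/-- The modified Hankel function (Macdonald function, modified Bessel function of the second
kind) `K_ν(z) = ∫_0^∞ exp(-z cosh s) cosh(ν s) ds`, for real order `ν` and argument `z > 0`. -/
def besselK (ν z : ℝ) : ℝ :=
  ∫ s in Set.Ioi (0 : ℝ), Real.exp (-z * Real.cosh s) * Real.cosh (ν * s)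

/-- The coefficients `a_{n,m}(γ)`, `0 ≤ m ≤ n` (zero for `m > n`, an unused value). -/
def coeffA (γ : ℝ) (n m : ℕ) : ℝ :=
  if n < m then 0
  else if m = 0 then 1
  else if m = n then -(γ / n) * coeffA γ (n - 1) (n - 1)
  else 1 / (2 * γ * m) *
    (4 * (((m + 1) / 2 : ℕ) : ℝ) ^ 2 * coeffA γ n (m + 1) -
      γ ^ 2 * ∑ k : Finset.Icc (m - 1) (n - 1),
        ((n : ℝ) - ((k : ℕ) : ℝ) + 1) * coeffA γ (k : ℕ) (m - 1))
termination_by (n, n - m)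
decreasing_by
  · exact Prod.Lex.left _ _ (by omega)
  · exact Prod.Lex.right _ (by omega)
  · have hk := Finset.mem_Icc.mp k.2
    exact Prod.Lex.left _ _ (by omega)

/-! The three defining relations of the coefficients. -/

theorem coeffA_zero (γ : ℝ) (n : ℕ) : coeffA γ n 0 = 1 := by
  rw [coeffA]; simp

theorem coeffA_diag (γ : ℝ) (n : ℕ) (hn : 1 ≤ n) :
    coeffA γ n n = -(γ / n) * coeffA γ (n - 1) (n - 1) := by
  rw [coeffA, if_neg (lt_irrefl n), if_neg (by omega), if_pos rfl]

theorem coeffA_rec (γ : ℝ) (n m : ℕ) (hm : 1 ≤ m) (hmn : m < n) :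
    coeffA γ n m = 1 / (2 * γ * m) *
      (4 * (((m + 1) / 2 : ℕ) : ℝ) ^ 2 * coeffA γ n (m + 1) -
        γ ^ 2 * ∑ k ∈ Finset.Icc (m - 1) (n - 1),
          ((n : ℝ) - (k : ℝ) + 1) * coeffA γ k (m - 1)) := by
  rw [coeffA, if_neg (by omega), if_neg (by omega), if_neg (by omega)]
  rw [← Finset.sum_coe_sort (Finset.Icc (m - 1) (n - 1))
    (fun k => ((n : ℝ) - (k : ℝ) + 1) * coeffA γ k (m - 1))]

/-- The polynomial `v_n(γ, r) = ∑_{m=0}^{[n/2]} a_{n,2m}(γ) r^{2m}`. -/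
def polyV (n : ℕ) (γ r : ℝ) : ℝ :=
  ∑ m ∈ Finset.range (n / 2 + 1), coeffA γ n (2 * m) * r ^ (2 * m)

/-- The polynomial `w_n(γ, r) = ∑_{m=0}^{[(n-1)/2]} a_{n,2m+1}(γ) r^{2m+1}`, with `w_0 = 0`;
the number of terms `[(n-1)/2] + 1` equals `[(n+1)/2]` for `n ≥ 1`. -/
def polyW (n : ℕ) (γ r : ℝ) : ℝ :=
  ∑ m ∈ Finset.range ((n + 1) / 2), coeffA γ n (2 * m + 1) * r ^ (2 * m + 1)

/-- `Φ_n(γ, r) = K_0(γ r) v_n(γ, r) + K_1(γ r) w_n(γ, r)` for `n ≥ 0`, and `Φ_n = 0` for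
`n < 0`. -/
def PhiFun (n : ℤ) (γ r : ℝ) : ℝ :=
  if n < 0 then 0
  else besselK 0 (γ * r) * polyV n.toNat γ r + besselK 1 (γ * r) * polyW n.toNat γ r

/-- The coefficients `χ_{k,n}`, `-2 ≤ k ≤ 2`. -/
def chiCoeff (k : ℤ) (n : ℕ) : ℝ :=
  if k = -2 then (n : ℝ) * ((n : ℝ) - 1)
  else if k = -1 then -4 * (n : ℝ) ^ 2
  else if k = 0 then 2 * (3 * (n : ℝ) ^ 2 + 3 * (n : ℝ) + 1)
  else if k = 1 then -4 * ((n : ℝ) + 1) ^ 2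
  else if k = 2 then ((n : ℝ) + 1) * ((n : ℝ) + 2)
  else 0

end

/-! With z = κr/a, the substitution t = (r/a) cosh s turns both integrals into ∫_0^∞ p(z cosh s)
e^{-z cosh s} ds with p a polynomial, so everything rests on the moments M_k = ∫_0^∞ (z cosh s)^k
e^{-z cosh s} ds. Put θ = z d/dz and B_m = z^m K_{m mod 2}(z). Then M_0 = B_0, M_{k+1} = (k - θ) M_k
and θ B_m = 2[m/2] B_m - B_{m+1}, which is where the recursion of `besselCoeff` comes from. The
proof never differentiates in z: integration by parts in s gives a recursion for M_k
(`coshMoment_add_two`), the coefficients obey the same one (`besselCoeff_add_two`), and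
`coshMoment_eq_besselSum` follows.

Bessel's equation (θ² - z²) M_0 = 0 extends to (θ² - z²) M_k = z² (k(k-1) M_{k-2} - 2k M_{k-1}), in
coefficients `besselCoeff_ode`. Summed against the coefficients of L_n, it becomes the recursion for
a_{n,m}/γ^m, whence `coeffA_eq` and the first integral. The second reduces to the first by expanding
x² L_n in L_{n-2}, ..., L_{n+2} (`sq_mul_laguerreL`). -/

/-! ### Coefficients of the moments M_k in the B_m -/

/-- Twice the integer part of `m / 2`. -/
noncomputable def evenFloor (m : ℤ) : ℝ := 2 * ((m / 2 : ℤ) : ℝ)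

theorem evenFloor_add_two (m : ℤ) : evenFloor (m + 2) = evenFloor m + 2 := by
  unfold evenFloor
  rw [show (m + 2) / 2 = m / 2 + 1 by omega]
  push_cast
  ring

theorem evenFloor_add_one_add (m : ℤ) : evenFloor (m + 1) + evenFloor m = 2 * m := by
  unfold evenFloor
  have h : (m + 1) / 2 + m / 2 = m := by omega
  have h' : (((m + 1) / 2 : ℤ) : ℝ) + ((m / 2 : ℤ) : ℝ) = m := by exact_mod_cast h
  linarith

/-- The coefficient of `z ^ m K_{m mod 2}(z)` in
`∫_0^∞ (z cosh s) ^ k exp (-z cosh s) ds`. -/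
noncomputable def besselCoeff : ℕ → ℤ → ℝ
  | 0, m => if m = 0 then 1 else 0
  | k + 1, m => (k - evenFloor m) * besselCoeff k m + besselCoeff k (m - 1)

theorem besselCoeff_succ (k : ℕ) (m : ℤ) :
    besselCoeff (k + 1) m = (k - evenFloor m) * besselCoeff k m + besselCoeff k (m - 1) := rfl

theorem besselCoeff_zero (m : ℤ) : besselCoeff 0 m = if m = 0 then 1 else 0 := rfl

theorem besselCoeff_one (m : ℤ) : besselCoeff 1 m = if m = 1 then 1 else 0 := by
  rw [besselCoeff_succ, besselCoeff_zero, besselCoeff_zero]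
  by_cases h0 : m = 0
  · subst h0; simp [evenFloor]
  · by_cases h1 : m = 1
    · subst h1; simp
    · simp [h0, h1, show m - 1 ≠ 0 by omega]

theorem besselCoeff_of_neg (k : ℕ) (m : ℤ) (hm : m < 0) : besselCoeff k m = 0 := by
  induction k generalizing m with
  | zero => simp [besselCoeff_zero, hm.ne]
  | succ k ih => rw [besselCoeff_succ, ih m hm, ih (m - 1) (by omega)]; ring

theorem besselCoeff_of_lt (k : ℕ) (m : ℤ) (hm : k < m) : besselCoeff k m = 0 := by
  induction k generalizing m with
  | zero => simp [besselCoeff_zero, show m ≠ 0 by push_cast at hm; omega]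
  | succ k ih =>
    push_cast at hm
    rw [besselCoeff_succ, ih m (by omega), ih (m - 1) (by omega)]; ring

theorem besselCoeff_self (k : ℕ) : besselCoeff k k = 1 := by
  induction k with
  | zero => simp [besselCoeff_zero]
  | succ k ih =>
    rw [besselCoeff_succ, besselCoeff_of_lt k _ (by push_cast; omega)]
    push_cast
    rw [add_sub_cancel_right, ih]; ring

theorem besselCoeff_succ_zero (k : ℕ) : besselCoeff (k + 1) 0 = 0 := by
  induction k with
  | zero => simp [besselCoeff_one]
  | succ k ih => rw [besselCoeff_succ, ih, besselCoeff_of_neg _ _ (by omega)]; ring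

/-- The coefficient of B_{m+2} in -θ M_{k+1} = z² (M_k - k M_{k-1}). The truncated `k - 1` at `k =
0` is harmless because of the factor `k`. -/
theorem besselCoeff_succ_sub (k : ℕ) (m : ℤ) :
    besselCoeff (k + 1) (m + 1) - evenFloor (m + 2) * besselCoeff (k + 1) (m + 2) =
      besselCoeff k m - k * besselCoeff (k - 1) m := by
  induction k generalizing m with
  | zero =>
    simp only [zero_add, besselCoeff_one, besselCoeff_zero]
    by_cases h0 : m = 0
    · subst h0; simp
    · by_cases h1 : m = -1
      · subst h1; simp [evenFloor]
      · simp [h0, show m + 2 ≠ 1 by omega]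
  | succ k ih =>
    have i1 := ih m
    have i2 := ih (m - 1)
    rw [besselCoeff_succ (k + 1) (m + 1), besselCoeff_succ (k + 1) (m + 2)]
    rw [show m + 2 - 1 = m + 1 by ring, show m + 1 - 1 = m by ring]
    rw [show m - 1 + 1 = m by ring, show m - 1 + 2 = m + 1 by ring] at i2
    have i3 := besselCoeff_succ k m
    have e := evenFloor_add_two m
    -- The recursion one index lower, multiplied by `k` so that it survives `k = 0`.
    have i4 : (k : ℝ) * besselCoeff k m =
        k * ((k - 1 - evenFloor m) * besselCoeff (k - 1) m + besselCoeff (k - 1) (m - 1)) := by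
      rcases k with _ | j
      · simp
      · rw [besselCoeff_succ j m, Nat.add_sub_cancel]; push_cast; ring
    rw [Nat.add_sub_cancel]
    push_cast
    rw [e] at i1 ⊢
    linear_combination (k + 1 - (evenFloor m + 2)) * i1 + i2 - i3 + i4

theorem besselCoeff_add_two (k : ℕ) (m : ℤ) :
    besselCoeff (k + 2) m = (k + 1) * besselCoeff (k + 1) m + besselCoeff k (m - 2) -
      k * besselCoeff (k - 1) (m - 2) := by
  have h := besselCoeff_succ_sub k (m - 2)
  rw [show m - 2 + 1 = m - 1 by ring, show m - 2 + 2 = m by ring] at h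
  rw [besselCoeff_succ (k + 1) m]
  push_cast
  linear_combination h

/-- The coefficient of B_{m+1} in the extended Bessel equation; the B_{m-1} contributions of θ² and
z² cancel. -/
theorem besselCoeff_ode (k : ℕ) (m : ℤ) :
    evenFloor (m + 1) ^ 2 * besselCoeff k (m + 1) - 2 * m * besselCoeff k m =
      k * (k - 1) * besselCoeff (k - 2) (m - 1) - 2 * k * besselCoeff (k - 1) (m - 1) := by
  rcases k with _ | _ | k
  · simp only [besselCoeff_zero]
    by_cases h0 : m = 0
    · subst h0; simp
    · by_cases h1 : m = -1
      · subst h1; simp [evenFloor]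
      · simp [h0, show m + 1 ≠ 0 by omega]
  · simp only [zero_add, besselCoeff_one]
    by_cases h0 : m = 0
    · subst h0; simp [evenFloor, besselCoeff_zero]
    · by_cases h1 : m = 1
      · subst h1; simp [besselCoeff_zero]
      · simp [h0, h1, besselCoeff_zero, show m - 1 ≠ 0 by omega]
  · have s1 := besselCoeff_succ_sub (k + 1) (m - 1)
    have s2 := besselCoeff_succ_sub (k + 1) (m - 2)
    have t1 := besselCoeff_succ (k + 1) (m - 1)
    have t2 := besselCoeff_succ k (m - 1)
    have e1 := evenFloor_add_two (m - 1)
    have e2 := evenFloor_add_one_add m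
    rw [show m - 1 + 1 = m by ring, show m - 1 + 2 = m + 1 by ring] at s1
    rw [show m - 2 + 1 = m - 1 by ring, show m - 2 + 2 = m by ring] at s2
    rw [show m - 1 - 1 = m - 2 by ring] at t1 t2
    rw [show m - 1 + 2 = m + 1 by ring] at e1
    simp only [Nat.add_sub_cancel, show k + 1 + 1 - 2 = k by omega] at *
    push_cast at *
    rw [← e2]
    have e3 : evenFloor (m - 1) = evenFloor (m + 1) - 2 := by linarith
    rw [e3] at t1 t2
    linear_combination (-evenFloor (m + 1)) * s1 + s2 - t1 + (k + 1) * t2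

/-! ### Laguerre sums and identification of the a_{n,m} -/

/-- The coefficient of `z ^ m K_{m mod 2}(z)` in
`∫_0^∞ L_n (z cosh s) exp (-z cosh s) ds`. -/
noncomputable def laguerreBesselCoeff (n : ℕ) (m : ℤ) : ℝ :=
  ∑ k ∈ Finset.range (n + 1), (n.choose k : ℝ) * ((-1) ^ k / (k.factorial : ℝ) * besselCoeff k m)

theorem laguerreBesselCoeff_eq_sum {n M : ℕ} (h : n < M) (m : ℤ) :
    laguerreBesselCoeff n m =
      ∑ k ∈ Finset.range M, (n.choose k : ℝ) * ((-1) ^ k / (k.factorial : ℝ) * besselCoeff k m) := by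
  unfold laguerreBesselCoeff
  refine Finset.sum_subset (Finset.range_subset_range.2 h) fun k _ hk => ?_
  rw [Finset.mem_range, not_lt] at hk
  rw [Nat.choose_eq_zero_of_lt (by omega)]; simp

theorem sum_range_choose_cast (n j : ℕ) :
    ∑ k ∈ Finset.range n, (k.choose j : ℝ) = n.choose (j + 1) := by
  induction n with
  | zero => simp
  | succ n ih => rw [Finset.sum_range_succ, ih, Nat.choose_succ_succ]; push_cast; ring

theorem sum_range_weight_choose (n j : ℕ) :
    ∑ k ∈ Finset.range n, ((n : ℝ) - k + 1) * (k.choose j : ℝ) =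
      n.choose (j + 2) + 2 * n.choose (j + 1) := by
  induction n with
  | zero => simp
  | succ n ih =>
    have h := sum_range_choose_cast n j
    rw [Finset.sum_range_succ, Nat.choose_succ_succ n (j + 1), Nat.choose_succ_succ n j]
    have : ∑ k ∈ Finset.range n, (((n + 1 : ℕ) : ℝ) - k + 1) * (k.choose j : ℝ) =
        ∑ k ∈ Finset.range n, ((n : ℝ) - k + 1) * (k.choose j : ℝ) +
          ∑ k ∈ Finset.range n, (k.choose j : ℝ) := by
      rw [← Finset.sum_add_distrib]
      refine Finset.sum_congr rfl fun k _ => ?_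
      push_cast; ring
    rw [this, ih, h]
    push_cast; ring

theorem laguerreBesselCoeff_ode (n : ℕ) (m : ℤ) :
    evenFloor (m + 1) ^ 2 * laguerreBesselCoeff n (m + 1) - 2 * m * laguerreBesselCoeff n m =
      ∑ k ∈ Finset.range n, ((n : ℝ) - k + 1) * laguerreBesselCoeff k (m - 1) := by
  have hR : ∑ k ∈ Finset.range n, ((n : ℝ) - k + 1) * laguerreBesselCoeff k (m - 1) =
      ∑ j ∈ Finset.range n, ((n.choose (j + 2) : ℝ) + 2 * n.choose (j + 1)) *
        ((-1) ^ j / (j.factorial : ℝ) * besselCoeff j (m - 1)) := by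
    calc _ = ∑ k ∈ Finset.range n, ∑ j ∈ Finset.range n, ((n : ℝ) - k + 1) * (k.choose j : ℝ) *
          ((-1) ^ j / (j.factorial : ℝ) * besselCoeff j (m - 1)) := by
          refine Finset.sum_congr rfl fun k hk => ?_
          rw [laguerreBesselCoeff_eq_sum (Finset.mem_range.1 hk), Finset.mul_sum]
          exact Finset.sum_congr rfl fun j _ => by ring
      _ = _ := by
          rw [Finset.sum_comm]
          refine Finset.sum_congr rfl fun j _ => ?_
          rw [← sum_range_weight_choose, Finset.sum_mul]
  have hL : evenFloor (m + 1) ^ 2 * laguerreBesselCoeff n (m + 1) -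
      2 * m * laguerreBesselCoeff n m =
      ∑ k ∈ Finset.range (n + 2), (n.choose k : ℝ) * ((-1) ^ k / (k.factorial : ℝ)) *
          (k * (k - 1) * besselCoeff (k - 2) (m - 1)) -
      ∑ k ∈ Finset.range (n + 1), (n.choose k : ℝ) * ((-1) ^ k / (k.factorial : ℝ)) *
          (2 * k * besselCoeff (k - 1) (m - 1)) := by
    -- The vanishing term k = n + 1 is added so that shifting the index by two leaves `range n`.
    rw [Finset.sum_range_succ _ (n + 1), Nat.choose_eq_zero_of_lt (Nat.lt_succ_self n)]
    unfold laguerreBesselCoeff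
    rw [Finset.mul_sum, Finset.mul_sum, ← Finset.sum_sub_distrib]
    simp only [Nat.cast_zero, zero_mul, add_zero]
    rw [← Finset.sum_sub_distrib]
    refine Finset.sum_congr rfl fun k _ => ?_
    linear_combination (n.choose k : ℝ) * ((-1) ^ k / (k.factorial : ℝ)) * besselCoeff_ode k m
  rw [hL, hR, Finset.sum_range_succ' _ (n + 1), Finset.sum_range_succ' _ n,
    Finset.sum_range_succ' _ n]
  simp only [Nat.cast_zero, zero_mul, mul_zero, add_zero, zero_add, Nat.cast_one, sub_self]
  rw [← Finset.sum_sub_distrib]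
  refine Finset.sum_congr rfl fun j _ => ?_
  have hj : (j.factorial : ℝ) ≠ 0 := by positivity
  have h1 : (j : ℝ) + 1 ≠ 0 := by positivity
  have h2 : (j : ℝ) + 1 + 1 ≠ 0 := by positivity
  simp only [show j + 1 + 1 - 2 = j by omega, Nat.add_sub_cancel, Nat.factorial_succ]
  push_cast
  field_simp
  ring

theorem laguerreBesselCoeff_zero (n : ℕ) : laguerreBesselCoeff n 0 = 1 := by
  unfold laguerreBesselCoeff
  rw [Finset.sum_range_succ', Finset.sum_eq_zero]
  · simp [besselCoeff_zero]
  · intro k _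
    rw [besselCoeff_succ_zero]; ring

theorem laguerreBesselCoeff_self (n : ℕ) :
    laguerreBesselCoeff n n = (-1) ^ n / (n.factorial : ℝ) := by
  unfold laguerreBesselCoeff
  rw [Finset.sum_range_succ, Finset.sum_eq_zero]
  · simp [besselCoeff_self]
  · intro k hk
    rw [besselCoeff_of_lt k n (by exact_mod_cast Finset.mem_range.1 hk)]; ring

theorem laguerreBesselCoeff_of_lt {n : ℕ} {m : ℤ} (h : n < m) : laguerreBesselCoeff n m = 0 := by
  refine Finset.sum_eq_zero fun k hk => ?_
  have := Finset.mem_range.1 hk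
  rw [besselCoeff_of_lt k m (by omega)]; ring

/-- Strong induction on n combined with descent in m from m = n, the order in which the a_{n,m} are
defined. -/
theorem coeffA_eq {γ : ℝ} (hγ : γ ≠ 0) (n m : ℕ) (h : m ≤ n) :
    coeffA γ n m = γ ^ m * laguerreBesselCoeff n m := by
  induction n using Nat.strong_induction_on generalizing m with
  | _ n ihn =>
    induction h using Nat.decreasingInduction with
    | self =>
      rcases n with _ | n
      · simp [coeffA_zero, laguerreBesselCoeff_zero]
      · rw [coeffA_diag γ _ (by omega), Nat.add_sub_cancel, ihn n (by omega) n le_rfl,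
          laguerreBesselCoeff_self, laguerreBesselCoeff_self, Nat.factorial_succ]
        have hj : (n.factorial : ℝ) ≠ 0 := by positivity
        have h1 : (n : ℝ) + 1 ≠ 0 := by positivity
        push_cast
        field_simp
        ring
    | of_succ m hm ih =>
      rcases m with _ | m
      · simp [coeffA_zero, laguerreBesselCoeff_zero]
      · rw [coeffA_rec γ n (m + 1) (by omega) hm, ih, Nat.add_sub_cancel]
        have ho := laguerreBesselCoeff_ode n ((m + 1 : ℕ) : ℤ)
        have hs : ∑ k ∈ Finset.Icc m (n - 1), ((n : ℝ) - k + 1) * coeffA γ k m =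
            γ ^ m * ∑ k ∈ Finset.range n,
              ((n : ℝ) - k + 1) * laguerreBesselCoeff k (((m + 1 : ℕ) : ℤ) - 1) := by
          rw [Finset.mul_sum]
          have hsub : Finset.Icc m (n - 1) ⊆ Finset.range n := by
            intro k hk
            rw [Finset.mem_Icc] at hk
            rw [Finset.mem_range]; omega
          rw [← Finset.sum_subset hsub]
          · refine Finset.sum_congr rfl fun k hk => ?_
            rw [Finset.mem_Icc] at hk
            rw [ihn k (by omega) m hk.1]
            push_cast
            rw [add_sub_cancel_right]; ring
          · intro k hk hk'
            rw [Finset.mem_range] at hk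
            rw [Finset.mem_Icc] at hk'
            rw [laguerreBesselCoeff_of_lt (by push_cast; omega)]; ring
        have he : evenFloor (((m + 1 : ℕ) : ℤ) + 1) = 2 * ((((m + 1) + 1) / 2 : ℕ) : ℝ) := by
          unfold evenFloor
          norm_cast
        rw [he] at ho
        rw [hs, ← ho]
        have h1 : (m : ℝ) + 1 ≠ 0 := by positivity
        push_cast
        field_simp
        ring

/-! ### The moments: convergence and recursion -/

open MeasureTheory Filter Topology Asymptotics in
theorem tendsto_pow_cosh_mul_exp {z : ℝ} (hz : 0 < z) (k : ℕ) :
    Tendsto (fun s : ℝ => (z * Real.cosh s) ^ k * Real.exp (-(z * Real.cosh s))) atTop (𝓝 0) := by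
  have hc : Tendsto Real.cosh atTop atTop := by
    refine tendsto_atTop_mono (fun s => ?_) (Real.tendsto_exp_atTop.atTop_div_const two_pos)
    rw [Real.cosh_eq]
    have := Real.exp_pos (-s)
    linarith
  exact (Real.tendsto_pow_mul_exp_neg_atTop_nhds_zero k).comp (hc.const_mul_atTop hz)

open MeasureTheory Filter Topology Asymptotics in
theorem integrableOn_pow_cosh_mul_exp {z : ℝ} (hz : 0 < z) (k : ℕ) :
    IntegrableOn (fun s : ℝ => (z * Real.cosh s) ^ k * Real.exp (-(z * Real.cosh s)))
      (Set.Ioi 0) := by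
  refine integrable_of_isBigO_exp_neg one_pos ?_ ?_
  · have := Real.continuous_cosh
    fun_prop
  · have h1 := (tendsto_pow_cosh_mul_exp hz (k + 1)).isBigO_one ℝ
    refine IsBigO.trans ?_
      (((isBigO_refl (fun s : ℝ => Real.exp (-1 * s)) atTop).mul h1).congr_right fun s => mul_one _)
    -- As 2 e^{-s} cosh s ≥ 1, the integrand is at most (2/z) e^{-s} times the one with exponent k +
    -- 1, which is bounded at infinity.
    refine IsBigO.of_bound (2 / z) (Eventually.of_forall fun s => ?_)
    have hc : 0 < z * Real.cosh s := mul_pos hz (Real.cosh_pos s)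
    rw [Real.norm_of_nonneg (by positivity), Real.norm_of_nonneg (by positivity)]
    have h2 : 1 ≤ Real.exp (-1 * s) * (2 * Real.cosh s) := by
      rw [Real.cosh_eq]
      have h3 : Real.exp (-1 * s) * Real.exp s = 1 := by rw [← Real.exp_add]; simp
      have := Real.exp_pos (-s)
      have := Real.exp_pos (-1 * s)
      nlinarith
    calc (z * Real.cosh s) ^ k * Real.exp (-(z * Real.cosh s))
        ≤ (z * Real.cosh s) ^ k * Real.exp (-(z * Real.cosh s)) *
            (Real.exp (-1 * s) * (2 * Real.cosh s)) :=
          le_mul_of_one_le_right (by positivity) h2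
      _ = _ := by rw [pow_succ]; field_simp

/-- The integral `∫_0^∞ (z cosh s) ^ k exp (-z cosh s) ds`. -/
noncomputable def coshMoment (z : ℝ) (k : ℕ) : ℝ :=
  ∫ s in Set.Ioi (0 : ℝ), (z * Real.cosh s) ^ k * Real.exp (-(z * Real.cosh s))

theorem coshMoment_zero (z : ℝ) : coshMoment z 0 = besselK 0 z := by
  simp [coshMoment, besselK]

theorem coshMoment_one (z : ℝ) : coshMoment z 1 = z * besselK 1 z := by
  unfold coshMoment besselK
  rw [← MeasureTheory.integral_const_mul]
  congr 1
  funext s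
  rw [pow_one, one_mul, neg_mul]; ring

-- Integrate the derivative of z sinh s (z cosh s)^k e^{-z cosh s}, using sinh² = cosh² - 1; both
-- boundary values are 0.
open MeasureTheory Filter Topology in
theorem coshMoment_add_two {z : ℝ} (hz : 0 < z) (k : ℕ) :
    coshMoment z (k + 2) = (k + 1) * coshMoment z (k + 1) + z ^ 2 * coshMoment z k -
      k * z ^ 2 * coshMoment z (k - 1) := by
  set g : ℕ → ℝ → ℝ := fun j s => (z * Real.cosh s) ^ j * Real.exp (-(z * Real.cosh s)) with hg
  have hi : ∀ j, IntegrableOn (g j) (Set.Ioi 0) := integrableOn_pow_cosh_mul_exp hz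
  have hd : ∀ s ∈ Set.Ici (0 : ℝ), HasDerivAt (fun s => z * Real.sinh s * g k s)
      ((k + 1) * g (k + 1) s + z ^ 2 * g k s - k * z ^ 2 * g (k - 1) s - g (k + 2) s) s := by
    intro s _
    have h1 : HasDerivAt (fun s => z * Real.cosh s) (z * Real.sinh s) s :=
      (Real.hasDerivAt_cosh s).const_mul z
    have h2 : HasDerivAt (fun s => z * Real.sinh s) (z * Real.cosh s) s :=
      (Real.hasDerivAt_sinh s).const_mul z
    refine (h2.mul ((h1.pow k).mul h1.neg.exp)).congr_deriv ?_
    have hs : (z * Real.sinh s) ^ 2 = (z * Real.cosh s) ^ 2 - z ^ 2 := by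
      rw [mul_pow, mul_pow, Real.sinh_sq]; ring
    have hk : (k : ℝ) * (z * Real.cosh s) ^ (k - 1) * (z * Real.cosh s) ^ 2 =
        k * (z * Real.cosh s) ^ (k + 1) := by
      rcases k with _ | k
      · simp
      · rw [Nat.add_sub_cancel]; ring
    simp only [hg, Pi.mul_apply, Pi.pow_apply]
    linear_combination (k * (z * Real.cosh s) ^ (k - 1) - (z * Real.cosh s) ^ k) *
      Real.exp (-(z * Real.cosh s)) * hs + Real.exp (-(z * Real.cosh s)) * hk
  have ht : Tendsto (fun s => z * Real.sinh s * g k s) atTop (𝓝 0) := by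
    refine squeeze_zero_norm (fun s => ?_) (tendsto_pow_cosh_mul_exp hz (k + 1))
    have hc := Real.cosh_pos s
    have hgs : 0 ≤ g k s := by simp only [hg]; positivity
    rw [norm_mul, norm_mul, Real.norm_of_nonneg hz.le, Real.norm_of_nonneg hgs, pow_succ']
    have h3 : ‖Real.sinh s‖ ≤ Real.cosh s := by
      rw [Real.norm_eq_abs]
      refine abs_le_of_sq_le_sq ?_ hc.le
      rw [Real.sinh_sq]; linarith
    calc _ ≤ z * Real.cosh s * g k s := by gcongr
      _ = _ := by simp only [hg]; ring
  have hA := (hi (k + 1)).const_mul ((k : ℝ) + 1)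
  have hB := (hi k).const_mul (z ^ 2)
  have hC := (hi (k - 1)).const_mul ((k : ℝ) * z ^ 2)
  have hAB : Integrable (fun s => ((k : ℝ) + 1) * g (k + 1) s + z ^ 2 * g k s)
      (volume.restrict (Set.Ioi 0)) := hA.add hB
  have hABC : Integrable (fun s => ((k : ℝ) + 1) * g (k + 1) s + z ^ 2 * g k s -
      k * z ^ 2 * g (k - 1) s) (volume.restrict (Set.Ioi 0)) := hAB.sub hC
  have h := integral_Ioi_of_hasDerivAt_of_tendsto' hd (hABC.sub (hi (k + 2))) ht
  rw [integral_sub hABC (hi (k + 2)), integral_sub hAB hC,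
    integral_add hA hB, integral_const_mul, integral_const_mul, integral_const_mul] at h
  simp only [Real.sinh_zero, mul_zero, zero_mul, sub_zero] at h
  unfold coshMoment
  linarith

/-! ### Moments and Φ_n in terms of K_0 and K_1 -/

/-- The sum of the first `M` terms `besselCoeff k m * z ^ m * K_{m mod 2}(z)`. -/
noncomputable def besselSum (z : ℝ) (k M : ℕ) : ℝ :=
  ∑ m ∈ Finset.range M, besselCoeff k m * (z ^ m * besselK ((m % 2 : ℕ) : ℝ) z)

theorem besselSum_eq {k M : ℕ} (h : k < M) (z : ℝ) : besselSum z k M = besselSum z k (k + 1) := by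
  symm
  refine Finset.sum_subset (Finset.range_subset_range.2 h) fun m _ hm => ?_
  rw [Finset.mem_range, not_lt] at hm
  rw [besselCoeff_of_lt k m (by omega), zero_mul]

theorem besselSum_add_two (z : ℝ) (k : ℕ) :
    besselSum z (k + 2) (k + 3) = (k + 1) * besselSum z (k + 1) (k + 2) +
      z ^ 2 * besselSum z k (k + 1) - k * z ^ 2 * besselSum z (k - 1) k := by
  have hs : ∀ j, ∑ m ∈ Finset.range (k + 3),
      besselCoeff j ((m : ℤ) - 2) * (z ^ m * besselK ((m % 2 : ℕ) : ℝ) z) =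
      z ^ 2 * besselSum z j (k + 1) := by
    intro j
    rw [Finset.sum_range_succ', Finset.sum_range_succ', besselSum, Finset.mul_sum]
    rw [besselCoeff_of_neg j (((0 : ℕ) : ℤ) - 2) (by norm_num),
      besselCoeff_of_neg j (((0 + 1 : ℕ) : ℤ) - 2) (by norm_num), zero_mul, zero_mul, add_zero,
      add_zero]
    refine Finset.sum_congr rfl fun m _ => ?_
    rw [show (((m + 1 + 1 : ℕ) : ℤ) - 2) = m by push_cast; ring,
      show (m + 1 + 1) % 2 = m % 2 by omega]
    ring
  have h : besselSum z (k + 2) (k + 3) = (k + 1) * besselSum z (k + 1) (k + 3) +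
      z ^ 2 * besselSum z k (k + 1) - k * (z ^ 2 * besselSum z (k - 1) (k + 1)) := by
    rw [← hs, ← hs]
    unfold besselSum
    rw [Finset.mul_sum, Finset.mul_sum, ← Finset.sum_add_distrib, ← Finset.sum_sub_distrib]
    refine Finset.sum_congr rfl fun m _ => ?_
    rw [besselCoeff_add_two]; ring
  rw [h, besselSum_eq (show k + 1 < k + 3 by omega)]
  rcases k with _ | k
  · simp
  · rw [Nat.add_sub_cancel, besselSum_eq (show k < k + 1 + 1 by omega)]
    ring

theorem coshMoment_eq_besselSum {z : ℝ} (hz : 0 < z) (k : ℕ) :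
    coshMoment z k = besselSum z k (k + 1) := by
  induction k using Nat.strong_induction_on with
  | _ k ih =>
    rcases k with _ | _ | k
    · simp [coshMoment_zero, besselSum, besselCoeff_zero]
    · simp [coshMoment_one, besselSum, besselCoeff_one]
    · rw [coshMoment_add_two hz, besselSum_add_two, ih k (by omega), ih (k + 1) (by omega)]
      rcases k with _ | k
      · simp
      · rw [Nat.add_sub_cancel, ih k (by omega)]

theorem sum_range_succ_eq_even_add_odd (f : ℕ → ℝ) (n : ℕ) :
    ∑ m ∈ Finset.range (n + 1), f m = ∑ m ∈ Finset.range (n / 2 + 1), f (2 * m) +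
      ∑ m ∈ Finset.range ((n + 1) / 2), f (2 * m + 1) := by
  induction n with
  | zero => simp
  | succ n ih =>
    rw [Finset.sum_range_succ, ih]
    rcases Nat.even_or_odd' n with ⟨j, rfl | rfl⟩
    · rw [show (2 * j + 1) / 2 = j by omega, show (2 * j + 1 + 1) / 2 = j + 1 by omega,
        show 2 * j / 2 = j by omega, Finset.sum_range_succ _ j,
        Finset.sum_range_succ (fun m => f (2 * m + 1)) j]
      ring
    · rw [show (2 * j + 1) / 2 = j by omega, show (2 * j + 1 + 1) / 2 = j + 1 by omega,
        show (2 * j + 1 + 1 + 1) / 2 = j + 1 by omega, Finset.sum_range_succ _ (j + 1),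
        show 2 * (j + 1) = 2 * j + 1 + 1 by ring]
      ring

theorem PhiFun_natCast_eq_sum {γ : ℝ} (hγ : 0 < γ) {r : ℝ} (hr : 0 < r) (n : ℕ) :
    PhiFun n γ r = ∑ k ∈ Finset.range (n + 1),
      (n.choose k : ℝ) * ((-1) ^ k / (k.factorial : ℝ)) * coshMoment (γ * r) k := by
  have h1 : PhiFun n γ r = ∑ m ∈ Finset.range (n + 1),
      laguerreBesselCoeff n m * ((γ * r) ^ m * besselK ((m % 2 : ℕ) : ℝ) (γ * r)) := by
    rw [sum_range_succ_eq_even_add_odd]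
    unfold PhiFun polyV polyW
    rw [if_neg (by omega), Int.toNat_natCast, Finset.mul_sum, Finset.mul_sum]
    congr 1 <;> refine Finset.sum_congr rfl fun m hm => ?_ <;> rw [Finset.mem_range] at hm
    · rw [coeffA_eq hγ.ne' n _ (by omega), show 2 * m % 2 = 0 by omega, Nat.cast_zero]
      ring
    · rw [coeffA_eq hγ.ne' n _ (by omega), show (2 * m + 1) % 2 = 1 by omega, Nat.cast_one]
      ring
  rw [h1]
  simp only [laguerreBesselCoeff, Finset.sum_mul]
  rw [Finset.sum_comm]
  refine Finset.sum_congr rfl fun k hk => ?_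
  rw [coshMoment_eq_besselSum (mul_pos hγ hr),
    ← besselSum_eq (Finset.mem_range.1 hk), besselSum, Finset.mul_sum]
  exact Finset.sum_congr rfl fun m _ => by ring

theorem exp_mul_laguerreL (n : ℕ) (x : ℝ) :
    Real.exp (-x) * laguerreL n x = ∑ k ∈ Finset.range (n + 1),
      (n.choose k : ℝ) * ((-1) ^ k / (k.factorial : ℝ)) * (x ^ k * Real.exp (-x)) := by
  unfold laguerreL
  rw [Finset.mul_sum]
  refine Finset.sum_congr rfl fun k _ => ?_
  rw [neg_pow]; ring

open MeasureTheory in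
theorem integrableOn_exp_mul_laguerreL_cosh {z : ℝ} (hz : 0 < z) (n : ℕ) :
    IntegrableOn (fun s : ℝ => Real.exp (-(z * Real.cosh s)) * laguerreL n (z * Real.cosh s))
      (Set.Ioi 0) := by
  simp only [exp_mul_laguerreL]
  exact integrable_finsetSum _ fun k _ => (integrableOn_pow_cosh_mul_exp hz k).const_mul _

open MeasureTheory in
theorem integral_exp_mul_laguerreL_cosh {γ : ℝ} (hγ : 0 < γ) {r : ℝ} (hr : 0 < r) (n : ℕ) :
    ∫ s in Set.Ioi (0 : ℝ),
      Real.exp (-(γ * r * Real.cosh s)) * laguerreL n (γ * r * Real.cosh s) = PhiFun n γ r := by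
  simp only [exp_mul_laguerreL]
  rw [integral_finsetSum _ fun k _ =>
    (integrableOn_pow_cosh_mul_exp (mul_pos hγ hr) k).const_mul _, PhiFun_natCast_eq_sum hγ hr]
  refine Finset.sum_congr rfl fun k _ => ?_
  rw [integral_const_mul, coshMoment]

/-! ### The substitution t = c cosh s -/

theorem image_mul_cosh_Ioi {c : ℝ} (hc : 0 < c) :
    (fun s => c * Real.cosh s) '' Set.Ioi 0 = Set.Ioi c := by
  ext t
  simp only [Set.mem_image, Set.mem_Ioi]
  constructor
  · rintro ⟨s, hs, rfl⟩
    exact lt_mul_of_one_lt_right hc (Real.one_lt_cosh.2 hs.ne')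
  · intro ht
    have h1 : 1 < t / c := (one_lt_div hc).2 ht
    refine ⟨Real.arcosh (t / c), Real.arcosh_pos h1, ?_⟩
    rw [Real.cosh_arcosh h1.le]
    field_simp

theorem injOn_mul_cosh {c : ℝ} (hc : 0 < c) :
    Set.InjOn (fun s => c * Real.cosh s) (Set.Ioi 0) := fun _ hx _ hy h =>
  Real.cosh_injOn (Set.mem_Ici.2 (le_of_lt hx)) (Set.mem_Ici.2 (le_of_lt hy))
    (mul_left_cancel₀ hc.ne' h)

theorem hasDerivWithinAt_mul_cosh (c : ℝ) (s : Set ℝ) :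
    ∀ x ∈ s, HasDerivWithinAt (fun s => c * Real.cosh s) (c * Real.sinh x) s x := fun x _ =>
  ((Real.hasDerivAt_cosh x).const_mul c).hasDerivWithinAt

theorem abs_deriv_smul_div_sqrt {c : ℝ} (hc : 0 < c) (f : ℝ → ℝ) {s : ℝ} (hs : s ∈ Set.Ioi 0) :
    |c * Real.sinh s| • (f (c * Real.cosh s) / Real.sqrt ((c * Real.cosh s) ^ 2 - c ^ 2)) =
      f (c * Real.cosh s) := by
  have h : 0 < c * Real.sinh s := mul_pos hc (Real.sinh_pos_iff.2 hs)
  rw [show (c * Real.cosh s) ^ 2 - c ^ 2 = (c * Real.sinh s) ^ 2 by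
    rw [mul_pow, mul_pow, Real.sinh_sq]; ring, Real.sqrt_sq h.le, abs_of_pos h, smul_eq_mul, mul_div_cancel₀ _ h.ne']

open MeasureTheory in
theorem integrableOn_div_sqrt_iff {c : ℝ} (hc : 0 < c) (f : ℝ → ℝ) :
    IntegrableOn (fun t => f t / Real.sqrt (t ^ 2 - c ^ 2)) (Set.Ioi c) ↔
      IntegrableOn (fun s => f (c * Real.cosh s)) (Set.Ioi 0) := by
  rw [← image_mul_cosh_Ioi hc, integrableOn_image_iff_integrableOn_abs_deriv_smul measurableSet_Ioi
    (hasDerivWithinAt_mul_cosh c _) (injOn_mul_cosh hc)]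
  exact integrableOn_congr_fun (fun s hs => abs_deriv_smul_div_sqrt hc f hs) measurableSet_Ioi

open MeasureTheory in
theorem integral_div_sqrt_eq {c : ℝ} (hc : 0 < c) (f : ℝ → ℝ) :
    ∫ t in Set.Ioi c, f t / Real.sqrt (t ^ 2 - c ^ 2) =
      ∫ s in Set.Ioi 0, f (c * Real.cosh s) := by
  rw [← image_mul_cosh_Ioi hc, integral_image_eq_integral_abs_deriv_smul measurableSet_Ioi
    (hasDerivWithinAt_mul_cosh c _) (injOn_mul_cosh hc)]
  exact setIntegral_congr_fun measurableSet_Ioi fun s hs => abs_deriv_smul_div_sqrt hc f hs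

/-! ### Laguerre recurrences and the main theorem -/

theorem laguerreL_eq_sum {n M : ℕ} (h : n < M) (t : ℝ) :
    laguerreL n t = ∑ k ∈ Finset.range M, (n.choose k : ℝ) * (-t) ^ k / (k.factorial : ℝ) := by
  refine Finset.sum_subset (Finset.range_subset_range.2 h) fun k _ hk => ?_
  rw [Finset.mem_range, not_lt] at hk
  rw [Nat.choose_eq_zero_of_lt (by omega)]; simp

theorem choose_laguerre_rec (n k : ℕ) :
    ((n : ℝ) + 1) * ((n + 1).choose (k + 1) : ℝ) - (2 * n + 1) * (n.choose (k + 1) : ℝ) +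
      n * ((n - 1).choose (k + 1) : ℝ) = (k + 1) * (n.choose k : ℝ) := by
  rcases n with _ | n
  · rcases k with _ | k
    · simp
    · simp [Nat.choose_eq_zero_of_lt (show 1 < k + 1 + 1 by omega)]
  · have h : ((n : ℝ) + 1) * (n.choose k : ℝ) = (n + 1 - k) * ((n + 1).choose k : ℝ) := by
      rcases le_or_gt k (n + 1) with hk | hk
      · have := congrArg (Nat.cast (R := ℝ)) (Nat.choose_mul_succ_eq n k)
        push_cast [Nat.cast_sub hk] at this
        linarith
      · rw [Nat.choose_eq_zero_of_lt hk, Nat.choose_eq_zero_of_lt (show n < k by omega)]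
        simp
    rw [Nat.choose_succ_succ (n + 1) k, Nat.choose_succ_succ n k, Nat.add_sub_cancel]
    push_cast [Nat.succ_eq_add_one]
    linear_combination -h

theorem mul_laguerreL (n : ℕ) (t : ℝ) :
    t * laguerreL n t = -(n + 1) * laguerreL (n + 1) t + (2 * n + 1) * laguerreL n t -
      n * laguerreL (n - 1) t := by
  have h : ((n : ℝ) + 1) * laguerreL (n + 1) t - (2 * n + 1) * laguerreL n t +
      n * laguerreL (n - 1) t = -t * laguerreL n t := by
    have hR : -t * laguerreL n t = ∑ k ∈ Finset.range (n + 1),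
        -t * ((n.choose k : ℝ) * (-t) ^ k / (k.factorial : ℝ)) := by
      rw [laguerreL, Finset.mul_sum]
    rw [hR, laguerreL_eq_sum (show n + 1 < n + 2 by omega),
      laguerreL_eq_sum (show n < n + 2 by omega), laguerreL_eq_sum (show n - 1 < n + 2 by omega),
      Finset.mul_sum, Finset.mul_sum, Finset.mul_sum, ← Finset.sum_sub_distrib,
      ← Finset.sum_add_distrib, Finset.sum_range_succ']
    have h0 : ((n : ℝ) + 1) - (2 * n + 1) + n = 0 := by ring
    simp only [Nat.choose_zero_right, pow_zero, Nat.factorial_zero, Nat.cast_one, mul_one, div_one,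
      h0, add_zero]
    refine Finset.sum_congr rfl fun k _ => ?_
    have hk : (k.factorial : ℝ) ≠ 0 := by positivity
    have h1 : (k : ℝ) + 1 ≠ 0 := by positivity
    rw [Nat.factorial_succ, pow_succ]
    push_cast
    rw [← sub_eq_zero]
    field_simp
    linear_combination -((-t) ^ k * t) * choose_laguerre_rec n k
  linarith

theorem sq_mul_laguerreL (n : ℕ) (t : ℝ) :
    t ^ 2 * laguerreL n t = n * (n - 1) * laguerreL (n - 2) t - 4 * n ^ 2 * laguerreL (n - 1) t +
      2 * (3 * n ^ 2 + 3 * n + 1) * laguerreL n t - 4 * (n + 1) ^ 2 * laguerreL (n + 1) t +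
      (n + 1) * (n + 2) * laguerreL (n + 2) t := by
  have h0 := mul_laguerreL n t
  have h1 := mul_laguerreL (n + 1) t
  rw [Nat.add_sub_cancel] at h1
  have h2 : (n : ℝ) * (t * laguerreL (n - 1) t) = n * (-n * laguerreL n t +
      (2 * n - 1) * laguerreL (n - 1) t - (n - 1) * laguerreL (n - 2) t) := by
    rcases n with _ | n
    · simp
    · rw [Nat.add_sub_cancel, mul_laguerreL n, show n + 1 - 2 = n - 1 by omega]
      push_cast; ring
  push_cast at h1
  linear_combination (t + 2 * n + 1) * h0 - (n + 1) * h1 - h2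

theorem sum_chiCoeff_mul (n : ℕ) (f : ℤ → ℝ) :
    ∑ k ∈ Finset.Icc (-2 : ℤ) 2, chiCoeff k n * f ((n : ℤ) + k) =
      n * (n - 1) * f ((n - 2 : ℕ) : ℤ) - 4 * n ^ 2 * f ((n - 1 : ℕ) : ℤ) +
      2 * (3 * n ^ 2 + 3 * n + 1) * f n - 4 * (n + 1) ^ 2 * f ((n + 1 : ℕ) : ℤ) +
      (n + 1) * (n + 2) * f ((n + 2 : ℕ) : ℤ) := by
  rw [show Finset.Icc (-2 : ℤ) 2 = {-2, -1, 0, 1, 2} by decide]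
  have h : ∀ g : ℤ → ℝ, ∑ k ∈ ({-2, -1, 0, 1, 2} : Finset ℤ), g k =
      g (-2) + (g (-1) + (g 0 + (g 1 + g 2))) := by
    intro g; simp
  rw [h]
  unfold chiCoeff
  norm_num
  -- For n = 0, 1 the truncated indices differ from n + k only where χ vanishes.
  rcases n with _ | _ | n
  · simp; ring
  · simp; ring
  · simp only [Nat.add_sub_cancel, show n + 1 + 1 - 2 = n by omega]
    rw [show ((n + 1 + 1 : ℕ) : ℤ) + -2 = n by push_cast; ring,
      show ((n + 1 + 1 : ℕ) : ℤ) + -1 = ((n + 1 : ℕ) : ℤ) by push_cast; ring]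
    ring

theorem mainTheorem2 (κ a r : ℝ) (hκ : 0 < κ) (ha : 0 < a) (hr : 0 < r) (n : ℕ) :
    (MeasureTheory.IntegrableOn
        (fun t : ℝ => Real.exp (-(κ * t)) * laguerreL n (κ * t) /
          Real.sqrt (t ^ 2 - (r / a) ^ 2)) (Set.Ioi (r / a)) ∧
      ∫ t in Set.Ioi (r / a),
        Real.exp (-(κ * t)) * laguerreL n (κ * t) / Real.sqrt (t ^ 2 - (r / a) ^ 2) =
          PhiFun (n : ℤ) (κ / a) r) ∧
    (MeasureTheory.IntegrableOn
        (fun t : ℝ => Real.exp (-(κ * t)) * (κ * t) ^ 2 * laguerreL n (κ * t) /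
          Real.sqrt (t ^ 2 - (r / a) ^ 2)) (Set.Ioi (r / a)) ∧
      ∫ t in Set.Ioi (r / a),
        Real.exp (-(κ * t)) * (κ * t) ^ 2 * laguerreL n (κ * t) /
          Real.sqrt (t ^ 2 - (r / a) ^ 2) =
          ∑ k ∈ Finset.Icc (-2 : ℤ) 2, chiCoeff k n * PhiFun ((n : ℤ) + k) (κ / a) r) := by
  have hγ : 0 < κ / a := div_pos hκ ha
  have hc : 0 < r / a := div_pos hr ha
  have hz : 0 < κ / a * r := mul_pos hγ hr
  have he : ∀ s, κ * (r / a * Real.cosh s) = κ / a * r * Real.cosh s := fun s => by ring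
  have hI := integrableOn_exp_mul_laguerreL_cosh hz
  have hP := fun j => integral_exp_mul_laguerreL_cosh hγ hr j
  rw [integrableOn_div_sqrt_iff hc (fun t => Real.exp (-(κ * t)) * laguerreL n (κ * t)),
    integral_div_sqrt_eq hc (fun t => Real.exp (-(κ * t)) * laguerreL n (κ * t)),
    integrableOn_div_sqrt_iff hc (fun t => Real.exp (-(κ * t)) * (κ * t) ^ 2 * laguerreL n (κ * t)),
    integral_div_sqrt_eq hc (fun t => Real.exp (-(κ * t)) * (κ * t) ^ 2 * laguerreL n (κ * t))]
  simp only [he]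
  refine ⟨⟨hI n, hP n⟩, ?_⟩
  have hq : (fun s : ℝ => Real.exp (-(κ / a * r * Real.cosh s)) * (κ / a * r * Real.cosh s) ^ 2 *
      laguerreL n (κ / a * r * Real.cosh s)) = fun s => ∑ k ∈ Finset.Icc (-2 : ℤ) 2, chiCoeff k n *
        (Real.exp (-(κ / a * r * Real.cosh s)) *
          laguerreL ((n : ℤ) + k).toNat (κ / a * r * Real.cosh s)) := by
    funext s
    rw [sum_chiCoeff_mul n fun j : ℤ => Real.exp (-(κ / a * r * Real.cosh s)) *
      laguerreL j.toNat (κ / a * r * Real.cosh s), mul_assoc, sq_mul_laguerreL]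
    simp only [Int.toNat_natCast]
    ring
  rw [hq]
  refine ⟨MeasureTheory.integrable_finsetSum _ fun k _ => (hI _).const_mul _, ?_⟩
  rw [MeasureTheory.integral_finsetSum _ fun k _ => (hI _).const_mul _]
  simp only [MeasureTheory.integral_const_mul, hP]
  -- Truncating the index by `toNat` does not change the sum: both versions have the same five-term
  -- expansion.
  rw [sum_chiCoeff_mul n fun j : ℤ => PhiFun (j.toNat : ℤ) (κ / a) r,
    sum_chiCoeff_mul n fun j : ℤ => PhiFun j (κ / a) r]
  simp only [Int.toNat_natCast]
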